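/- **Definition.** A *3-crossed module* consists of groups and homomorphisms $M\xrightarrow{\partial}L\xrightarrow{\partial}H\xrightarrow{\partial}G$ with $\partial\circ\partial=1$, left actions by automorphisms (written ${}^{a}b$) of $G$ on $H,L,M$, of $H$ on $L,M$ and of $L$ on $M$ (each of $G,H,L$ also acting on itself by conjugation), and functions $\{-,-\}:H\times H\to L$ (Peiffer lifting), $\{-,-,-\},\{-,-,-\}':H\times H\times H\to M$ (left and right Homanian), $\{-,-\}_{HL},\{-,-\}'_{HL}:H\times L\to M$ and $\{-,-\}_{LL}:L\times L\to M$, such that for all $g\in G$, $h,h_i\in H$, $l,l',l_i\in L$, $m,m'\in M$: 1. $\partial({}^{g}h)={}^{g}\partial h$, $\partial({}^{g}l)={}^{g}\partial l$, $\partial({}^{g}m)={}^{g}\partial m$, $\partial({}^{h}l)={}^{h}\partial l$, $\partial({}^{h}m)={}^{h}\partial m$, $\partial({}^{l}m)={}^{l}\partial m$; 2. ${}^{g}\{h_2,h_1\}=\{{}^{g}h_2,{}^{g}h_1\}$, ${}^{g}\{h_3,h_2,h_1\}=\{{}^{g}h_3,{}^{g}h_2,{}^{g}h_1\}$, ${}^{g}\{h_3,h_2,h_1\}'=\{{}^{g}h_3,{}^{g}h_2,{}^{g}h_1\}'$,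 ${}^{g}\{l_2,l_1\}_{LL}=\{{}^{g}l_2,{}^{g}l_1\}_{LL}$, ${}^{h}\{l_2,l_1\}_{LL}=\{{}^{h}l_2,{}^{h}l_1\}_{LL}$, ${}^{g}\{h,l\}_{HL}=\{{}^{g}h,{}^{g}l\}_{HL}$, ${}^{g}\{h,l\}'_{HL}=\{{}^{g}h,{}^{g}l\}'_{HL}$; 3. ${}^{\partial m}m'=mm'm^{-1}$; 4. $\partial\{h,l\}_{HL}\,{}^{h}l=l\{\partial l^{-1},h\}$ and $\partial\{h,l\}'_{HL}\,{}^{\partial h}l={}^{h}l\,\{h,\partial l^{-1}\}$; 5. ${}^{h}m=m\{h,\partial m^{-1}\}_{HL}$ and ${}^{\partial h}m={}^{h}m\,\{h,\partial m^{-1}\}'_{HL}$; 6. $\partial\{l,l'\}_{LL}\,{}^{\partial l}l'=ll'l^{-1}$; 7. $\{l_3l_2,l_1\}_{LL}={}^{l_3}\{l_2,l_1\}_{LL}\{l_3,{}^{\partial l_2}l_1\}_{LL}$ and $\{l_3,l_2l_1\}_{LL}=\{l_3,l_2\}_{LL}\,{}^{({}^{\partial l_3}l_2)}\{l_3,l_1\}_{LL}$;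 8. $\{h_3h_2,h_1\}=\partial\{h_3,h_2,h_1\}\;{}^{h_3}\{h_2,h_1\}\{h_3,{}^{\partial h_2}h_1\}$ and $\{h_3,h_2h_1\}=\partial\{h_3,h_2,h_1\}'\{h_3,h_2\}\,{}^{({}^{\partial h_3}h_2)}\{h_3,h_1\}$; 9. $\{h_2h_1,l\}_{HL}={}^{l}\{\partial l^{-1},h_2,h_1\}'\{h_2,l\}_{HL}\,{}^{h_2}\{h_1,l\}_{HL}$; 10. $\{h,l_2l_1\}_{HL}={}^{l_2l_1}\{\partial l_1^{-1},\partial l_2^{-1},h\}\;{}^{l_2l_1}\{l_1^{-1},\{\partial l_2^{-1},h\}\}_{LL}^{-1}\,\{h,l_2\}_{HL}\,{}^{({}^{h}l_2)}\{h,l_1\}_{HL}$; 11. $\{h_2h_1,l\}'_{HL}={}^{({}^{h_2h_1}l)}\{h_2,h_1,\partial l^{-1}\}\;{}^{h_2}\{h_1,l\}'_{HL}\,\{h_2,{}^{\partial h_1}l\}'_{HL}$; 12. $\{h,l_2l_1\}'_{HL}={}^{({}^{h}(l_2l_1))}\{h,\partial l_1^{-1},\partial l_2^{-1}\}'\;{}^{({}^{h}l_2)}\{h,l_1\}'_{HL}\;{}^{({}^{h}l_2\,{}^{\partial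 h}l_1)}\{{}^{\partial h}l_1^{-1},\{h,\partial l_2^{-1}\}\}_{LL}^{-1}\,\{h,l_2\}'_{HL}$; 13. $\{h_4h_3,h_2,h_1\}\;{}^{({}^{h_4h_3}\{h_2,h_1\})}\{h_4,h_3,{}^{\partial h_2}h_1\}=\{h_4,h_3h_2,h_1\}\;{}^{h_4}\{h_3,h_2,h_1\}$; 14. $\{h_4,h_3h_2,h_1\}'\{h_4,h_3,h_2\}'=\{h_4,h_3,h_2h_1\}'\;{}^{\{h_4,h_3\}}\bigl({}^{({}^{\partial h_4}h_3)}\{h_4,h_2,h_1\}'\bigr)$; 15. $\{h_4,h_3,h_2h_1\}\;{}^{({}^{h_4}\{h_3,h_2h_1\})}\{h_4,{}^{\partial h_3}h_2,{}^{\partial h_3}h_1\}'\;{}^{h_4}\{h_3,h_2,h_1\}'$ $=\{h_4h_3,h_2,h_1\}'\;{}^{\{h_4h_3,h_2\}}\bigl({}^{({}^{\partial(h_4h_3)}h_2)}\{h_4,h_3,h_1\}\bigr)\{h_4,h_3,h_2\}\;{}^{({}^{h_4}\{h_3,h_2\})}\bigl\{\{h_4,{}^{\partial h_3}h_2\},{}^{({}^{\partial(h_4h_3)}h_2\,h_4)}\{h_3,h_1\}\bigr\}_{LL}$;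 16. ${}^{({}^{h_3}\{h_2,h_1\})}\bigl((\{h_3,{}^{\partial h_2}h_1,h_2\}')^{-1}\{h_3,\partial\{h_2,h_1\}^{-1},h_2h_1\}'\bigr)\,\{h_3,\{h_2,h_1\}\}'_{HL}\,\bigl\{{}^{\partial h_3}\{h_2,h_1\},{}^{\partial({}^{\partial h_3}\{h_2,h_1\}^{-1})}\{h_3,h_2h_1\}\bigr\}_{LL}\,\{h_3,h_2,h_1\}'$ $=\{h_3,h_2,h_1\}^{-1}\;{}^{\{h_3h_2,h_1\}}\{{}^{\partial(h_3h_2)}h_1,\{h_3,h_2\}\}_{HL}^{-1}\,\bigl\{\{h_3,h_2\},{}^{\partial\{h_3,h_2\}^{-1}}\{h_3h_2,h_1\}\bigr\}_{LL}^{-1}\;{}^{\{h_3,h_2\}}\bigl(\{\partial\{h_3,h_2\}^{-1},h_3h_2,h_1\}^{-1}\{{}^{\partial h_3}h_2,h_3,h_1\}\bigr)$; 17. ${}^{l}\{\partial l',l^{-1}\}_{HL}\;{}^{ll'l^{-1}l'^{-1}}\{l',l\}_{LL}={}^{({}^{\partial l}l')}\{\partial l,l'^{-1}\}'_{HL}\,\{l,l'\}_{LL}^{-1}$;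 18. $\{\partial m,l\}_{LL}\{l,\partial m\}_{LL}=\{\partial l,\partial m\}_{HL}=(\{\partial l,\partial m\}'_{HL})^{-1}$; 19. $\{\partial m,\partial m'\}_{LL}=mm'm^{-1}m'^{-1}$. **Theorem.** Let $X$ be a simplicial group with face homomorphisms $d_i:X_n\to X_{n-1}$ and degeneracy homomorphisms $s_i:X_n\to X_{n+1}$ ($0\le i\le n$). Let $XN_0=X_0$, let $XN_n=\bigcap_{i=0}^{n-1}\ker(d_i:X_n\to X_{n-1})$ for $n\ge1$, and let $\operatorname{Im}(d_4)=d_4(XN_4)$, a normal subgroup of $XN_3$. Put $$M=XN_3/\operatorname{Im}(d_4)\xrightarrow{\ \partial\ }L=XN_2\xrightarrow{\ \partial\ }H=XN_1\xrightarrow{\ \partial\ }G=XN_0,$$ where the maps $\partial$ are induced by $d_3$, $d_2$, $d_1$. Then this sequence is a 3-crossed module with the following (well-defined) data, where $m\in XN_3$ also stands for its class in $M$ and each word in $X_3$ below lies in $XN_3$ and stands for its class in $M$. * Actions: ${}^{g}h=s_0g\cdot h\cdot s_0g^{-1}$, ${}^{g}l=s_1s_0g\cdot l\cdot s_1s_0g^{-1}$,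 ${}^{g}m=s_2s_1s_0g\cdot m\cdot s_2s_1s_0g^{-1}$, ${}^{h}l=s_1h\cdot l\cdot s_1h^{-1}$, ${}^{h}m=s_2s_1h\cdot m\cdot s_2s_1h^{-1}$, ${}^{l}m=s_2l\cdot m\cdot s_2l^{-1}$. * $\{h_1,h_2\}=s_1h_1\, s_1h_2\, s_1h_1^{-1}\, s_0h_1\, s_1h_2^{-1}\, s_0h_1^{-1}$. * $\{l_1,l_2\}_{LL}=s_2l_1\, s_2l_2\, s_2l_1^{-1}\, s_1l_1\, s_2l_2^{-1}\, s_1l_1^{-1}$. * $\{h,l\}_{HL}=s_2l\; s_1l^{-1}\; s_2s_1h\; s_1l\; s_0l^{-1}\; s_2s_1h^{-1}\; s_0l\; s_2s_1h\; s_2l^{-1}\; s_2s_1h^{-1}$. * $\{h,l\}'_{HL}=s_2s_1h\; s_2l\; s_1l^{-1}\; s_2s_1h^{-1}\; s_2s_0h\; s_1l\; s_2s_0h^{-1}\; s_1s_0h\; s_2l^{-1}\; s_1s_0h^{-1}$. * With $a_i=s_2s_1h_i$, $b_i=s_2s_0h_i$, $c_i=s_1s_0h_i$: $$\{h_1,h_2,h_3\}=a_1a_2a_3a_2^{-1}a_1^{-1}b_1b_2a_3^{-1}b_2^{-1}c_2a_3c_2^{-1}b_1^{-1}a_1c_2a_3^{-1}c_2^{-1}b_2a_3b_2^{-1}a_2a_3^{-1}a_2^{-1}a_1^{-1},$$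 $$\{h_1,h_2,h_3\}'=a_1a_2a_3a_1^{-1}b_1a_3^{-1}a_2^{-1}b_1^{-1}c_1a_2c_1^{-1}b_1a_3b_1^{-1}a_1a_3^{-1}a_1^{-1}c_1a_2^{-1}c_1^{-1}b_1a_2b_1^{-1}a_1a_2^{-1}a_1^{-1}.$$ Moreover $\partial\{h_2,h_1\}=h_2h_1h_2^{-1}\,{}^{\partial h_2}h_1^{-1}$ for all $h_1,h_2\in H$. -/

import Mathlib

open CategoryTheory Simplicial

universe u v w x

/-- A 3-crossed module structure on four groups `M → L → H → G`.

The fields up to `ll` are the data: the boundary maps, the six left actions by automorphisms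
(`actAB a b` is `ᵃb`), and the six liftings:
* `pf h₂ h₁` is the Peiffer lifting `{h₂, h₁}`;
* `lh h₃ h₂ h₁` is the left Homanian `{h₃, h₂, h₁}`;
* `rh h₃ h₂ h₁` is the right Homanian `{h₃, h₂, h₁}'`;
* `hl h l` is the HL-Peiffer lifting `{h, l}_HL`;
* `hl' h l` is the HL'-Peiffer lifting `{h, l}'_HL`;
* `ll l₂ l₁` is the LL-Peiffer lifting `{l₂, l₁}_LL`.

The remaining fields are the axioms. Each of `G`, `H`, `L` acts on itself by conjugation, and these
actions are written out. -/
structure ThreeCrossedModule (G : Type u) (H : Type v) (L : Type w) (M : Type x)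
    [Group G] [Group H] [Group L] [Group M] where
  dM : M →* L
  dL : L →* H
  dH : H →* G
  actGH : G →* MulAut H
  actGL : G →* MulAut L
  actGM : G →* MulAut M
  actHL : H →* MulAut L
  actHM : H →* MulAut M
  actLM : L →* MulAut M
  pf : H → H → L
  lh : H → H → H → M
  rh : H → H → H → M
  hl : H → L → M
  hl' : H → L → M
  ll : L → L → M
  dL_dM : ∀ m, dL (dM m) = 1
  dH_dL : ∀ l, dH (dL l) = 1
  dH_actGH : ∀ g h, dH (actGH g h) = g * dH h * g⁻¹
  dL_actGL : ∀ g l, dL (actGL g l) = actGH g (dL l)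
  dM_actGM : ∀ g m, dM (actGM g m) = actGL g (dM m)
  dL_actHL : ∀ h l, dL (actHL h l) = h * dL l * h⁻¹
  dM_actHM : ∀ h m, dM (actHM h m) = actHL h (dM m)
  dM_actLM : ∀ l m, dM (actLM l m) = l * dM m * l⁻¹
  actG_pf : ∀ g h₂ h₁, actGL g (pf h₂ h₁) = pf (actGH g h₂) (actGH g h₁)
  actG_lh : ∀ g h₃ h₂ h₁,
    actGM g (lh h₃ h₂ h₁) = lh (actGH g h₃) (actGH g h₂) (actGH g h₁)
  actG_rh : ∀ g h₃ h₂ h₁,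
    actGM g (rh h₃ h₂ h₁) = rh (actGH g h₃) (actGH g h₂) (actGH g h₁)
  actG_ll : ∀ g l₂ l₁, actGM g (ll l₂ l₁) = ll (actGL g l₂) (actGL g l₁)
  actH_ll : ∀ h l₂ l₁, actHM h (ll l₂ l₁) = ll (actHL h l₂) (actHL h l₁)
  actLM_dM : ∀ m m', actLM (dM m) m' = m * m' * m⁻¹
  dM_hl : ∀ h l, dM (hl h l) * actHL h l = l * pf (dL l⁻¹) h
  dM_hl' : ∀ h l, dM (hl' h l) * actGL (dH h) l = actHL h l * pf h (dL l⁻¹)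
  actG_hl : ∀ g h l, actGM g (hl h l) = hl (actGH g h) (actGL g l)
  actG_hl' : ∀ g h l, actGM g (hl' h l) = hl' (actGH g h) (actGL g l)
  actHM_eq : ∀ h m, actHM h m = m * hl h (dM m⁻¹)
  dM_ll : ∀ l l', dM (ll l l') * actHL (dL l) l' = l * l' * l⁻¹
  ll_mul_left : ∀ l₃ l₂ l₁,
    ll (l₃ * l₂) l₁ = actLM l₃ (ll l₂ l₁) * ll l₃ (actHL (dL l₂) l₁)
  ll_mul_right : ∀ l₃ l₂ l₁,
    ll l₃ (l₂ * l₁) = ll l₃ l₂ * actLM (actHL (dL l₃) l₂) (ll l₃ l₁)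
  actGM_dH : ∀ h m, actGM (dH h) m = actHM h m * hl' h (dM m⁻¹)
  pf_mul_left : ∀ h₃ h₂ h₁,
    pf (h₃ * h₂) h₁ = dM (lh h₃ h₂ h₁) * actHL h₃ (pf h₂ h₁) * pf h₃ (actGH (dH h₂) h₁)
  pf_mul_right : ∀ h₃ h₂ h₁,
    pf h₃ (h₂ * h₁) = dM (rh h₃ h₂ h₁) * pf h₃ h₂ * actHL (actGH (dH h₃) h₂) (pf h₃ h₁)
  hl_mul_left : ∀ h₂ h₁ l,
    hl (h₂ * h₁) l = actLM l (rh (dL l⁻¹) h₂ h₁) * hl h₂ l * actHM h₂ (hl h₁ l)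
  hl_mul_right : ∀ h l₂ l₁,
    hl h (l₂ * l₁) =
      actLM (l₂ * l₁) (lh (dL l₁⁻¹) (dL l₂⁻¹) h) *
      (actLM (l₂ * l₁) (ll l₁⁻¹ (pf (dL l₂⁻¹) h)))⁻¹ *
      hl h l₂ * actLM (actHL h l₂) (hl h l₁)
  hl'_mul_left : ∀ h₂ h₁ l,
    hl' (h₂ * h₁) l =
      actLM (actHL (h₂ * h₁) l) (lh h₂ h₁ (dL l⁻¹)) *
      actHM h₂ (hl' h₁ l) * hl' h₂ (actGL (dH h₁) l)
  hl'_mul_right : ∀ h l₂ l₁,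
    hl' h (l₂ * l₁) =
      actLM (actHL h (l₂ * l₁)) (rh h (dL l₁⁻¹) (dL l₂⁻¹)) *
      actLM (actHL h l₂) (hl' h l₁) *
      (actLM (actHL h l₂ * actGL (dH h) l₁) (ll (actGL (dH h) l₁⁻¹) (pf h (dL l₂⁻¹))))⁻¹ *
      hl' h l₂
  lh_cocycle : ∀ h₄ h₃ h₂ h₁,
    lh (h₄ * h₃) h₂ h₁ *
      actLM (actHL (h₄ * h₃) (pf h₂ h₁)) (lh h₄ h₃ (actGH (dH h₂) h₁)) =
    lh h₄ (h₃ * h₂) h₁ * actHM h₄ (lh h₃ h₂ h₁)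
  rh_cocycle : ∀ h₄ h₃ h₂ h₁,
    rh h₄ (h₃ * h₂) h₁ * rh h₄ h₃ h₂ =
    rh h₄ h₃ (h₂ * h₁) *
      actLM (pf h₄ h₃) (actHM (actGH (dH h₄) h₃) (rh h₄ h₂ h₁))
  lh_rh : ∀ h₄ h₃ h₂ h₁,
    lh h₄ h₃ (h₂ * h₁) *
      actLM (actHL h₄ (pf h₃ (h₂ * h₁))) (rh h₄ (actGH (dH h₃) h₂) (actGH (dH h₃) h₁)) *
      actHM h₄ (rh h₃ h₂ h₁) =
    rh (h₄ * h₃) h₂ h₁ *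
      actLM (pf (h₄ * h₃) h₂) (actHM (actGH (dH (h₄ * h₃)) h₂) (lh h₄ h₃ h₁)) *
      lh h₄ h₃ h₂ *
      actLM (actHL h₄ (pf h₃ h₂))
        (ll (pf h₄ (actGH (dH h₃) h₂)) (actHL (actGH (dH (h₄ * h₃)) h₂ * h₄) (pf h₃ h₁)))
  yang_baxter : ∀ h₃ h₂ h₁,
    actLM (actHL h₃ (pf h₂ h₁))
        ((rh h₃ (actGH (dH h₂) h₁) h₂)⁻¹ * rh h₃ (dL (pf h₂ h₁)⁻¹) (h₂ * h₁)) *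
      hl' h₃ (pf h₂ h₁) *
      ll (actGL (dH h₃) (pf h₂ h₁))
        (actHL (dL (actGL (dH h₃) (pf h₂ h₁)⁻¹)) (pf h₃ (h₂ * h₁))) *
      rh h₃ h₂ h₁ =
    (lh h₃ h₂ h₁)⁻¹ *
      (actLM (pf (h₃ * h₂) h₁) (hl (actGH (dH (h₃ * h₂)) h₁) (pf h₃ h₂)))⁻¹ *
      (ll (pf h₃ h₂) (actHL (dL (pf h₃ h₂)⁻¹) (pf (h₃ * h₂) h₁)))⁻¹ *
      actLM (pf h₃ h₂)
        ((lh (dL (pf h₃ h₂)⁻¹) (h₃ * h₂) h₁)⁻¹ * lh (actGH (dH h₃) h₂) h₃ h₁)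
  hl_ll_hl' : ∀ l l',
    actLM l (hl (dL l') l⁻¹) * actLM (l * l' * l⁻¹ * l'⁻¹) (ll l' l) =
    actLM (actHL (dL l) l') (hl' (dL l) l'⁻¹) * (ll l l')⁻¹
  ll_mul_ll_eq_hl : ∀ l m, ll (dM m) l * ll l (dM m) = hl (dL l) (dM m)
  hl_eq_hl'_inv : ∀ l m, hl (dL l) (dM m) = (hl' (dL l) (dM m))⁻¹
  ll_dM_dM : ∀ m m', ll (dM m) (dM m') = m * m' * m⁻¹ * m'⁻¹

/-- A simplicial group. -/
abbrev SimplicialGroup := SimplicialObject GrpCat.{u}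

namespace SimplicialGroup

variable (X : SimplicialGroup.{u})

/-- The face homomorphism `d_i : X_{n+1} → X_n`. -/
def face (n : ℕ) (i : Fin (n + 2)) : X _⦋n + 1⦌ →* X _⦋n⦌ := (X.δ i).hom

/-- The degeneracy homomorphism `s_i : X_n → X_{n+1}`. -/
def degen (n : ℕ) (i : Fin (n + 1)) : X _⦋n⦌ →* X _⦋n + 1⦌ := (X.σ i).hom

/-- The `n`-th group of the Moore complex: the elements of `X_n` killed by `d_0, …, d_{n-1}`
(so all of `X_0` for `n = 0`). -/
def moore (n : ℕ) : Subgroup (X _⦋n⦌) :=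
  match n with
  | 0 => (⊤)
  | n + 1 => ⨅ i : Fin (n + 1), (face X n i.castSucc).ker

/-- The image `d_4(N X_4)` of the Moore boundary, as a subgroup of `X_3`. -/
def boundaries : Subgroup (X _⦋3⦌) := (moore X 4).map (face X 3 (Fin.last 4))

theorem boundaries_le : boundaries X ≤ moore X 3 := by
  rintro _ ⟨y, hy, rfl⟩
  simp only [moore, SetLike.mem_coe, Subgroup.mem_iInf, MonoidHom.mem_ker] at hy ⊢
  intro i
  have h : X.δ (Fin.last 4) ≫ X.δ i.castSucc = X.δ i.castSucc.castSucc ≫ X.δ (Fin.last 3) := by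
    have := X.δ_comp_δ (i := i.castSucc) (j := Fin.last 3) (Fin.le_last _)
    simpa using this
  have h' := congrArg (fun f => (GrpCat.Hom.hom f) y) h
  have hy' : GrpCat.Hom.hom (X.δ i.castSucc.castSucc) y = 1 := hy i.castSucc
  simp only [GrpCat.hom_comp, MonoidHom.comp_apply] at h'
  rw [hy', map_one] at h'
  exact h'

theorem boundaries_normal : (boundaries X).Normal := by
  constructor
  rintro _ ⟨y, hy, rfl⟩ g
  refine ⟨degen X 3 (Fin.last 3) g * y * (degen X 3 (Fin.last 3) g)⁻¹, ?_, ?_⟩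
  · simp only [moore, SetLike.mem_coe, Subgroup.mem_iInf, MonoidHom.mem_ker] at hy ⊢
    intro i
    rw [map_mul, map_mul, hy i, map_inv]
    group
  · have h : face X 3 (Fin.last 4) (degen X 3 (Fin.last 3) g) = g := by
      have := X.δ_comp_σ_succ (i := Fin.last 3)
      exact congrArg (fun f => (GrpCat.Hom.hom f) g) this
    rw [map_mul, map_mul, map_inv, h]

instance : ((boundaries X).subgroupOf (moore X 3)).Normal :=
  (boundaries_normal X).subgroupOf _

/-- The quotient group `N X_3 / d_4(N X_4)`. -/
abbrev TopQuotient : Type u := moore X 3 ⧸ (boundaries X).subgroupOf (moore X 3)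

/-- `s_1 s_0 : X_0 → X_2`. -/
def s₁s₀' : X _⦋0⦌ →* X _⦋2⦌ := (degen X 1 1).comp (degen X 0 0)

/-- `s_2 s_1 s_0 : X_0 → X_3`. -/
def s₂s₁s₀ : X _⦋0⦌ →* X _⦋3⦌ := (degen X 2 2).comp (s₁s₀' X)

/-- `s_2 s_1 : X_1 → X_3`. -/
def s₂s₁ : X _⦋1⦌ →* X _⦋3⦌ := (degen X 2 2).comp (degen X 1 1)

/-- `s_2 s_0 : X_1 → X_3`. -/
def s₂s₀ : X _⦋1⦌ →* X _⦋3⦌ := (degen X 2 2).comp (degen X 1 0)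

/-- `s_1 s_0 : X_1 → X_3`. -/
def s₁s₀ : X _⦋1⦌ →* X _⦋3⦌ := (degen X 2 1).comp (degen X 1 0)

/-- The word in `X_2` defining the Peiffer lifting. -/
def peifferWord (h₁ h₂ : X _⦋1⦌) : X _⦋2⦌ :=
  degen X 1 1 h₁ * degen X 1 1 h₂ * degen X 1 1 h₁⁻¹ *
  degen X 1 0 h₁ * degen X 1 1 h₂⁻¹ * degen X 1 0 h₁⁻¹

/-- The word in `X_3` defining the LL-Peiffer lifting. -/
def llWord (l₁ l₂ : X _⦋2⦌) : X _⦋3⦌ :=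
  degen X 2 2 l₁ * degen X 2 2 l₂ * degen X 2 2 l₁⁻¹ *
  degen X 2 1 l₁ * degen X 2 2 l₂⁻¹ * degen X 2 1 l₁⁻¹

/-- The word in `X_3` defining the HL-Peiffer lifting. -/
def hlWord (h : X _⦋1⦌) (l : X _⦋2⦌) : X _⦋3⦌ :=
  degen X 2 2 l * degen X 2 1 l⁻¹ * s₂s₁ X h * degen X 2 1 l * degen X 2 0 l⁻¹ *
  s₂s₁ X h⁻¹ * degen X 2 0 l * s₂s₁ X h *
  degen X 2 2 l⁻¹ * s₂s₁ X h⁻¹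

/-- The word in `X_3` defining the HL'-Peiffer lifting. -/
def hl'Word (h : X _⦋1⦌) (l : X _⦋2⦌) : X _⦋3⦌ :=
  s₂s₁ X h * degen X 2 2 l * degen X 2 1 l⁻¹ * s₂s₁ X h⁻¹ *
  s₂s₀ X h * degen X 2 1 l * s₂s₀ X h⁻¹ *
  s₁s₀ X h * degen X 2 2 l⁻¹ * s₁s₀ X h⁻¹

/-- The word in `X_3` defining the left Homanian. -/
def lhWord (h₁ h₂ h₃ : X _⦋1⦌) : X _⦋3⦌ :=
  s₂s₁ X h₁ * s₂s₁ X h₂ * s₂s₁ X h₃ * s₂s₁ X h₂⁻¹ *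
  s₂s₁ X h₁⁻¹ * s₂s₀ X h₁ * s₂s₀ X h₂ * s₂s₁ X h₃⁻¹ *
  s₂s₀ X h₂⁻¹ * s₁s₀ X h₂ * s₂s₁ X h₃ * s₁s₀ X h₂⁻¹ *
  s₂s₀ X h₁⁻¹ * s₂s₁ X h₁ * s₁s₀ X h₂ * s₂s₁ X h₃⁻¹ *
  s₁s₀ X h₂⁻¹ * s₂s₀ X h₂ * s₂s₁ X h₃ * s₂s₀ X h₂⁻¹ *
  s₂s₁ X h₂ * s₂s₁ X h₃⁻¹ * s₂s₁ X h₂⁻¹ * s₂s₁ X h₁⁻¹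

/-- The word in `X_3` defining the right Homanian. -/
def rhWord (h₁ h₂ h₃ : X _⦋1⦌) : X _⦋3⦌ :=
  s₂s₁ X h₁ * s₂s₁ X h₂ * s₂s₁ X h₃ * s₂s₁ X h₁⁻¹ *
  s₂s₀ X h₁ * s₂s₁ X h₃⁻¹ * s₂s₁ X h₂⁻¹ * s₂s₀ X h₁⁻¹ *
  s₁s₀ X h₁ * s₂s₁ X h₂ * s₁s₀ X h₁⁻¹ * s₂s₀ X h₁ *
  s₂s₁ X h₃ * s₂s₀ X h₁⁻¹ * s₂s₁ X h₁ * s₂s₁ X h₃⁻¹ *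
  s₂s₁ X h₁⁻¹ * s₁s₀ X h₁ * s₂s₁ X h₂⁻¹ * s₁s₀ X h₁⁻¹ *
  s₂s₀ X h₁ * s₂s₁ X h₂ * s₂s₀ X h₁⁻¹ * s₂s₁ X h₁ *
  s₂s₁ X h₂⁻¹ * s₂s₁ X h₁⁻¹

/-- `m ∈ N X_3 / d_4(N X_4)` is the class of the element `y` of `X_3`, which lies in `N X_3`. -/
def IsClassOf (m : TopQuotient X) (y : X _⦋3⦌) : Prop :=
  ∃ hy : y ∈ moore X 3, m = QuotientGroup.mk (⟨y, hy⟩ : moore X 3)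

end SimplicialGroup

/-!
Every axiom is an equation between words in degeneracies and faces of variables that range over
`N X_0`, `N X_1`, `N X_2` and `N X_3`. It is therefore a statement about the free simplicial group
`F` generated by copies of `Δ[0]` and of `Δ[k]` for `k = 1, 2, 3`, with the simplices of the horns
`Λ[k]_k ⊆ Δ[k]` set equal to `1`: a choice of elements in the Moore complex of `X` is the same thing
as a map `F → X`. A simplex of `Δ[k]` is a monotone map `[n] → [k]`, and extending it by the
value `k` at `n + 1` sends simplices of the horn `Λ[k]_k` to simplices of that horn. So `F` has an
extra degeneracy `t : F_n → F_{n+1}`, with `d_i t = t d_i` for `i ≤ n` and `d_{n+1} t = 1`. If all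
the faces of `y ∈ F_3` are trivial, then `t y` lies in the Moore complex and `d_4 (t y) = y`, so that
`y` is a boundary. Consequently an equation between elements of `N X_3 / d_4 (N X_4)` holds as soon
as the two sides have the same faces `d_0, …, d_3` in `F_2`, which is an equality of reduced words
in a free group.

The free group is made concrete by encoding a monotone map `[n] → [k]` by its `k` jumps
(`operatorOfCuts`): faces and degeneracies then act on each jump separately, and the extra degeneracy
leaves the code unchanged and merely reads it in the next dimension. The simplices of the horn, which
the Moore complex kills, are those with a jump at `0` or with a repeated jump (`eval_prune`). The
contraction is `eval_mem_boundaries`, and `eq_of_spellsClass` is the resulting criterion. The classes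
`Spells` and `SpellsClass` find the word of an expression built from the boundary maps, the actions
and the liftings; the equalities of reduced words that remain are decidable.
-/

namespace SimplicialGroup

/-! ### Formal words in degeneracies -/

/-- Words in formal simplices. The letter `(j, c)` stands for the simplex obtained from the `j`-th
variable of dimension `k = c.length` by the simplicial operator `[n] → [k]` that sends `i` to the
number of entries of `c` that are at most `i`. Every monotone map arises in this way, and a letter
makes sense in each dimension `n`. -/
abbrev Word := FreeGroup (ℕ × List ℕ)

namespace Word

/-- The `j`-th variable of dimension `k`, without any degeneracy. -/
def var (k j : ℕ) : Word := FreeGroup.of (j, List.range' 1 k)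

/-- The face operator `d_a` on words. -/
def face (a : ℕ) : Word →* Word :=
  FreeGroup.map fun p ↦ (p.1, p.2.map fun c ↦ if c ≤ a then c else c - 1)

/-- The degeneracy operator `s_a` on words. -/
def degen (a : ℕ) : Word →* Word :=
  FreeGroup.map fun p ↦ (p.1, p.2.map fun c ↦ if c ≤ a then c else c + 1)

/-- Delete the letters in whose code `0` or a repeated entry occurs. Their operator `[n] → [k]` misses
a value below `k`, so they are trivial when the variables take values in the Moore complex. -/
def prune : Word →* Word :=
  FreeGroup.lift fun p ↦ if 0 ∈ p.2 ∨ ¬ p.2.Nodup then 1 else FreeGroup.of p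

end Word

/-- The monotone map `[n] → [k]` that sends `i` to the number of entries of `c` that are at most
`i` (cut off at `k`, which has no effect when `c` has length `k`). -/
def operatorOfCuts (n k : ℕ) (c : List ℕ) : ⦋n⦌ ⟶ ⦋k⦌ :=
  SimplexCategory.mkHom
    { toFun := fun i ↦ ⟨min k (c.countP (· ≤ i.val)), by omega⟩
      monotone' := fun i j hij ↦ by
        have : c.countP (· ≤ i.val) ≤ c.countP (· ≤ j.val) :=
          List.countP_mono_left fun x _ hx ↦ by
            simp only [decide_eq_true_eq] at hx ⊢
            exact hx.trans hij
        simp only [Fin.mk_le_mk]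
        omega }

theorem operatorOfCuts_apply (n k : ℕ) (c : List ℕ) (i : Fin (n + 1)) :
    ((operatorOfCuts n k c).toOrderHom i : ℕ) = min k (c.countP (· ≤ i.val)) := rfl

theorem operatorOfCuts_face (n k : ℕ) (a : Fin (n + 2)) (c : List ℕ) :
    operatorOfCuts n k (c.map fun c ↦ if c ≤ a.val then c else c - 1) =
      SimplexCategory.δ a ≫ operatorOfCuts (n + 1) k c := by
  apply SimplexCategory.Hom.ext
  ext i
  change min k _ = min k (List.countP (fun x : ℕ ↦ decide (x ≤ (a.succAbove i).val)) c)
  rw [List.countP_map]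
  congr 1
  apply List.countP_congr
  intro x _
  simp only [Function.comp_apply, decide_eq_true_eq, Fin.succAbove, Fin.lt_def, Fin.val_castSucc]
  split_ifs <;> simp only [Fin.val_castSucc, Fin.val_succ] <;> omega

theorem operatorOfCuts_degen (n k : ℕ) (a : Fin (n + 1)) (c : List ℕ) :
    operatorOfCuts (n + 1) k (c.map fun c ↦ if c ≤ a.val then c else c + 1) =
      SimplexCategory.σ a ≫ operatorOfCuts n k c := by
  apply SimplexCategory.Hom.ext
  ext i
  change min k _ = min k (List.countP (fun x : ℕ ↦ decide (x ≤ (a.predAbove i).val)) c)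
  rw [List.countP_map]
  congr 1
  apply List.countP_congr
  intro x _
  simp only [Function.comp_apply, decide_eq_true_eq, Fin.predAbove, Fin.lt_def, Fin.val_castSucc]
  split_ifs <;> simp only [Fin.coe_castPred, Fin.val_pred] <;> omega

theorem operatorOfCuts_range' (k : ℕ) : operatorOfCuts k k (List.range' 1 k) = 𝟙 ⦋k⦌ := by
  apply SimplexCategory.Hom.ext
  ext i
  have key : ∀ k i : ℕ, (List.range' 1 k).countP (· ≤ i) = min k i := by
    intro k i
    induction k with
    | zero => simp
    | succ k ih =>
      rw [List.range'_1_concat, List.countP_append, ih, List.countP_singleton]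
      simp only [decide_eq_true_eq]
      split_ifs <;> omega
  change min k _ = (i : ℕ)
  rw [key]
  have : i.val < k + 1 := i.isLt
  omega

/-- If `0` occurs in `c`, then the operator misses `0`; if `x` occurs twice, then it misses the
value one above the number of entries smaller than `x`. -/
theorem exists_operatorOfCuts_ne (n : ℕ) (c : List ℕ) (hc : 0 ∈ c ∨ ¬ c.Nodup) :
    ∃ v < c.length, ∀ i, ((operatorOfCuts n c.length c).toOrderHom i : ℕ) ≠ v := by
  have hle : ∀ i : ℕ, c.countP (· ≤ i) ≤ c.length := fun i ↦ List.countP_le_length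
  rcases hc with hc | hc
  · refine ⟨0, List.length_pos_of_mem hc, fun i ↦ ?_⟩
    rw [operatorOfCuts_apply]
    have h : 0 < c.countP (· ≤ i.val) := List.countP_pos_iff.2 ⟨0, hc, by simp⟩
    have := hle i
    omega
  · obtain ⟨x, hx⟩ := List.exists_duplicate_iff_not_nodup.2 hc
    rw [List.duplicate_iff_two_le_count] at hx
    have hsum : ∀ l : List ℕ, l.countP (· < x) + l.count x ≤ l.countP (· ≤ x) := by
      intro l
      induction l with
      | nil => simp
      | cons y l ih =>
        simp only [List.countP_cons, List.count_cons, decide_eq_true_eq, beq_iff_eq]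
        split_ifs <;> omega
    refine ⟨c.countP (· < x) + 1, ?_, fun i ↦ ?_⟩
    · have := hsum c
      have := hle x
      omega
    · rw [operatorOfCuts_apply]
      have := hsum c
      have := hle i
      by_cases hi : x ≤ i.val
      · have : c.countP (· ≤ x) ≤ c.countP (· ≤ i.val) :=
          List.countP_mono_left fun y _ hy ↦ by
            simp only [decide_eq_true_eq] at hy ⊢
            exact hy.trans hi
        omega
      · have : c.countP (· ≤ i.val) ≤ c.countP (· < x) :=
          List.countP_mono_left fun y _ hy ↦ by
            simp only [decide_eq_true_eq] at hy ⊢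
            omega
        omega

variable {X : SimplicialGroup.{u}}

/-- An element of the Moore complex is killed by every operator `[n] → [k]` that misses a value
below `k`. -/
theorem map_eq_one_of_ne {n k : ℕ} (f : ⦋n⦌ ⟶ ⦋k⦌) (y : moore X k) (v : ℕ) (hv : v < k)
    (hf : ∀ i, (f.toOrderHom i : ℕ) ≠ v) : (X.map f.op).hom (y : X _⦋k⦌) = 1 := by
  obtain _ | k := k
  · omega
  obtain ⟨g, rfl⟩ := SimplexCategory.eq_comp_δ_of_not_surjective' f
    (Fin.castSucc ⟨v, hv⟩) fun i h ↦ hf i (congrArg Fin.val h)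
  have hy : (X.δ (Fin.castSucc ⟨v, hv⟩)).hom (y : X _⦋k + 1⦌) = 1 := by
    have := y.2
    simp only [moore, Subgroup.mem_iInf, MonoidHom.mem_ker] at this
    exact this ⟨v, hv⟩
  rw [op_comp, X.map_comp, GrpCat.hom_comp, MonoidHom.comp_apply]
  change (X.map g.op).hom ((X.δ _).hom _) = 1
  rw [hy, map_one]

/-! ### Evaluation of words -/

variable (X) in
/-- Values in the Moore complex for the variables of each dimension. -/
abbrev Assignment := ∀ k, ℕ → moore X k

/-- The value of a word in dimension `n`. -/
def eval (e : Assignment X) (n : ℕ) : Word →* X _⦋n⦌ :=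
  FreeGroup.lift fun p ↦
    (X.map (operatorOfCuts n p.2.length p.2).op).hom (e p.2.length p.1 : X _⦋p.2.length⦌)

variable (e : Assignment X)

theorem eval_face (n : ℕ) (a : Fin (n + 2)) (w : Word) :
    eval e n (Word.face a w) = face X n a (eval e (n + 1) w) := by
  suffices (eval e n).comp (Word.face a) = (face X n a).comp (eval e (n + 1)) from
    DFunLike.congr_fun this w
  refine FreeGroup.ext_hom _ _ fun p ↦ ?_
  simp only [eval, Word.face, MonoidHom.comp_apply, FreeGroup.map.of, FreeGroup.lift_apply_of]
  rw [List.length_map, operatorOfCuts_face, op_comp, X.map_comp]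
  rfl

theorem eval_degen (n : ℕ) (a : Fin (n + 1)) (w : Word) :
    eval e (n + 1) (Word.degen a w) = degen X n a (eval e n w) := by
  suffices (eval e (n + 1)).comp (Word.degen a) = (degen X n a).comp (eval e n) from
    DFunLike.congr_fun this w
  refine FreeGroup.ext_hom _ _ fun p ↦ ?_
  simp only [eval, Word.degen, MonoidHom.comp_apply, FreeGroup.map.of, FreeGroup.lift_apply_of]
  rw [List.length_map, operatorOfCuts_degen, op_comp, X.map_comp]
  rfl

theorem eval_prune (n : ℕ) (w : Word) : eval e n (Word.prune w) = eval e n w := by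
  suffices (eval e n).comp Word.prune = eval e n from DFunLike.congr_fun this w
  refine FreeGroup.ext_hom _ _ fun p ↦ ?_
  simp only [Word.prune, MonoidHom.comp_apply, FreeGroup.lift_apply_of]
  split_ifs with h
  · obtain ⟨v, hv, hne⟩ := exists_operatorOfCuts_ne n p.2 h
    rw [map_one, eval, FreeGroup.lift_apply_of, map_eq_one_of_ne _ _ v hv hne]
  · rfl

theorem eval_var (k j : ℕ) : eval e k (Word.var k j) = e k j := by
  simp only [eval, Word.var, FreeGroup.lift_apply_of]
  rw [List.length_range', operatorOfCuts_range', op_id, X.map_id]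
  rfl

theorem eval_eq_eval (n : ℕ) {w w' : Word} (h : Word.prune w = Word.prune w') :
    eval e n w = eval e n w' := by
  rw [← eval_prune, h, eval_prune]

theorem eval_mem_moore (n : ℕ) (w : Word) (h : ∀ a < n, Word.prune (Word.face a w) = 1) :
    eval e n w ∈ moore X n := by
  obtain _ | n := n
  · exact Subgroup.mem_top _
  simp only [moore, Subgroup.mem_iInf, MonoidHom.mem_ker]
  intro a
  rw [← eval_face, ← eval_prune, Fin.val_castSucc, h a a.isLt, map_one]

/-- The contraction: reading a word of dimension `3` in dimension `4` provides an extra degeneracy,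
so that a word all of whose faces are trivial evaluates to a boundary. The face `d_4` of the word
read in dimension `4` is the word itself. -/
theorem eval_mem_boundaries (w : Word) (h : ∀ a < 4, Word.prune (Word.face a w) = 1)
    (h₄ : Word.prune (Word.face 4 w) = Word.prune w) : eval e 3 w ∈ boundaries X := by
  refine ⟨eval e 4 w, eval_mem_moore e 4 w h, ?_⟩
  rw [← eval_face]
  exact eval_eq_eval e 3 h₄

/-- Two words of dimension `3` with the same faces have the same value modulo boundaries. The last
hypothesis holds when all the jumps in the two words are at most `4`, as they are for words of
dimension `3`. -/
theorem inv_mul_eval_mem_boundaries {w w' : Word}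
    (h : ∀ a < 4, Word.prune (Word.face a w) = Word.prune (Word.face a w'))
    (h₄ : Word.face 4 w = w ∧ Word.face 4 w' = w') :
    (eval e 3 w)⁻¹ * eval e 3 w' ∈ boundaries X := by
  rw [← map_inv, ← map_mul]
  apply eval_mem_boundaries
  · intro a ha
    rw [map_mul, map_inv, map_mul, map_inv, h a ha, inv_mul_cancel]
  · rw [map_mul, map_inv, h₄.1, h₄.2]

/-! ### The words of the liftings -/

namespace Word

/-- The word of the Peiffer lifting. -/
def peiffer (h₁ h₂ : Word) : Word :=
  degen 1 h₁ * degen 1 h₂ * degen 1 h₁⁻¹ * degen 0 h₁ * degen 1 h₂⁻¹ * degen 0 h₁⁻¹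

/-- The word of the LL-Peiffer lifting. -/
def ll (l₁ l₂ : Word) : Word :=
  degen 2 l₁ * degen 2 l₂ * degen 2 l₁⁻¹ * degen 1 l₁ * degen 2 l₂⁻¹ * degen 1 l₁⁻¹

/-- The degeneracy `s_2 s_1 : X_1 → X_3` on words. -/
def s₂s₁ (h : Word) : Word := degen 2 (degen 1 h)

/-- The degeneracy `s_2 s_0 : X_1 → X_3` on words. -/
def s₂s₀ (h : Word) : Word := degen 2 (degen 0 h)

/-- The degeneracy `s_1 s_0 : X_1 → X_3` on words. -/
def s₁s₀ (h : Word) : Word := degen 1 (degen 0 h)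

/-- The word of the HL-Peiffer lifting. -/
def hl (h l : Word) : Word :=
  degen 2 l * degen 1 l⁻¹ * s₂s₁ h * degen 1 l * degen 0 l⁻¹ *
  s₂s₁ h⁻¹ * degen 0 l * s₂s₁ h * degen 2 l⁻¹ * s₂s₁ h⁻¹

/-- The word of the HL'-Peiffer lifting. -/
def hl' (h l : Word) : Word :=
  s₂s₁ h * degen 2 l * degen 1 l⁻¹ * s₂s₁ h⁻¹ * s₂s₀ h * degen 1 l * s₂s₀ h⁻¹ *
  s₁s₀ h * degen 2 l⁻¹ * s₁s₀ h⁻¹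

/-- The word of the left Homanian. -/
def lh (h₁ h₂ h₃ : Word) : Word :=
  s₂s₁ h₁ * s₂s₁ h₂ * s₂s₁ h₃ * s₂s₁ h₂⁻¹ *
  s₂s₁ h₁⁻¹ * s₂s₀ h₁ * s₂s₀ h₂ * s₂s₁ h₃⁻¹ *
  s₂s₀ h₂⁻¹ * s₁s₀ h₂ * s₂s₁ h₃ * s₁s₀ h₂⁻¹ *
  s₂s₀ h₁⁻¹ * s₂s₁ h₁ * s₁s₀ h₂ * s₂s₁ h₃⁻¹ *
  s₁s₀ h₂⁻¹ * s₂s₀ h₂ * s₂s₁ h₃ * s₂s₀ h₂⁻¹ *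
  s₂s₁ h₂ * s₂s₁ h₃⁻¹ * s₂s₁ h₂⁻¹ * s₂s₁ h₁⁻¹

/-- The word of the right Homanian. -/
def rh (h₁ h₂ h₃ : Word) : Word :=
  s₂s₁ h₁ * s₂s₁ h₂ * s₂s₁ h₃ * s₂s₁ h₁⁻¹ *
  s₂s₀ h₁ * s₂s₁ h₃⁻¹ * s₂s₁ h₂⁻¹ * s₂s₀ h₁⁻¹ *
  s₁s₀ h₁ * s₂s₁ h₂ * s₁s₀ h₁⁻¹ * s₂s₀ h₁ *
  s₂s₁ h₃ * s₂s₀ h₁⁻¹ * s₂s₁ h₁ * s₂s₁ h₃⁻¹ *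
  s₂s₁ h₁⁻¹ * s₁s₀ h₁ * s₂s₁ h₂⁻¹ * s₁s₀ h₁⁻¹ *
  s₂s₀ h₁ * s₂s₁ h₂ * s₂s₀ h₁⁻¹ * s₂s₁ h₁ *
  s₂s₁ h₂⁻¹ * s₂s₁ h₁⁻¹

end Word

/-- The element `y` of `X_n` is the value of the word `w`. Instances of this class compute `w` from
the way in which `y` is written. -/
class Spells (n : ℕ) (y : X _⦋n⦌) (w : outParam Word) : Prop where
  eq : y = eval e n w

instance (k j : ℕ) : Spells e k (e k j : X _⦋k⦌) (Word.var k j) := ⟨(eval_var e k j).symm⟩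

instance (n : ℕ) (y z : X _⦋n⦌) (v w : Word) [hy : Spells e n y v] [hz : Spells e n z w] :
    Spells e n (y * z) (v * w) := ⟨by rw [map_mul, ← hy.eq, ← hz.eq]⟩

instance (n : ℕ) (y : X _⦋n⦌) (w : Word) [hy : Spells e n y w] : Spells e n y⁻¹ w⁻¹ :=
  ⟨by rw [map_inv, ← hy.eq]⟩

instance (n : ℕ) : Spells e n (1 : X _⦋n⦌) 1 := ⟨(map_one _).symm⟩

instance (n : ℕ) (a : Fin (n + 2)) (y : X _⦋n + 1⦌) (w : Word) [hy : Spells e (n + 1) y w] :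
    Spells e n (face X n a y) (Word.face a w) := ⟨by rw [eval_face, ← hy.eq]⟩

instance (n : ℕ) (a : Fin (n + 1)) (y : X _⦋n⦌) (w : Word) [hy : Spells e n y w] :
    Spells e (n + 1) (degen X n a y) (Word.degen a w) := ⟨by rw [eval_degen, ← hy.eq]⟩

instance (y : X _⦋1⦌) (w : Word) [hy : Spells e 1 y w] : Spells e 3 (s₂s₁ X y) (Word.s₂s₁ w) :=
  inferInstanceAs (Spells e 3 (degen X 2 2 (degen X 1 1 y)) _)

instance (y : X _⦋1⦌) (w : Word) [hy : Spells e 1 y w] : Spells e 3 (s₂s₀ X y) (Word.s₂s₀ w) :=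
  inferInstanceAs (Spells e 3 (degen X 2 2 (degen X 1 0 y)) _)

instance (y : X _⦋1⦌) (w : Word) [hy : Spells e 1 y w] : Spells e 3 (s₁s₀ X y) (Word.s₁s₀ w) :=
  inferInstanceAs (Spells e 3 (degen X 2 1 (degen X 1 0 y)) _)

instance (y : X _⦋0⦌) (w : Word) [hy : Spells e 0 y w] :
    Spells e 2 (s₁s₀' X y) (Word.degen 1 (Word.degen 0 w)) :=
  inferInstanceAs (Spells e 2 (degen X 1 1 (degen X 0 0 y)) _)

instance (y : X _⦋0⦌) (w : Word) [hy : Spells e 0 y w] :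
    Spells e 3 (s₂s₁s₀ X y) (Word.degen 2 (Word.degen 1 (Word.degen 0 w))) :=
  inferInstanceAs (Spells e 3 (degen X 2 2 (s₁s₀' X y)) _)

instance (y z : X _⦋1⦌) (v w : Word) [Spells e 1 y v] [Spells e 1 z w] :
    Spells e 2 (peifferWord X y z) (Word.peiffer v w) := by
  unfold peifferWord Word.peiffer; infer_instance

instance (y z : X _⦋2⦌) (v w : Word) [Spells e 2 y v] [Spells e 2 z w] :
    Spells e 3 (llWord X y z) (Word.ll v w) := by
  unfold llWord Word.ll; infer_instance

instance (y : X _⦋1⦌) (z : X _⦋2⦌) (v w : Word) [Spells e 1 y v] [Spells e 2 z w] :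
    Spells e 3 (hlWord X y z) (Word.hl v w) := by
  unfold hlWord Word.hl; infer_instance

instance (y : X _⦋1⦌) (z : X _⦋2⦌) (v w : Word) [Spells e 1 y v] [Spells e 2 z w] :
    Spells e 3 (hl'Word X y z) (Word.hl' v w) := by
  unfold hl'Word Word.hl'; infer_instance

instance (x y z : X _⦋1⦌) (u v w : Word) [Spells e 1 x u] [Spells e 1 y v] [Spells e 1 z w] :
    Spells e 3 (lhWord X x y z) (Word.lh u v w) := by
  unfold lhWord Word.lh; infer_instance

instance (x y z : X _⦋1⦌) (u v w : Word) [Spells e 1 x u] [Spells e 1 y v] [Spells e 1 z w] :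
    Spells e 3 (rhWord X x y z) (Word.rh u v w) := by
  unfold rhWord Word.rh; infer_instance

theorem eq_of_spells (n : ℕ) {y z : X _⦋n⦌} {v w : Word} [hy : Spells e n y v]
    [hz : Spells e n z w] (h : Word.prune v = Word.prune w) : y = z := by
  rw [hy.eq, hz.eq, eval_eq_eval e n h]

theorem mem_moore_of_spells (n : ℕ) (y : X _⦋n⦌) {w : Word} [hy : Spells e n y w]
    (h : ∀ a < n, Word.prune (Word.face a w) = 1) : y ∈ moore X n := by
  rw [hy.eq]
  exact eval_mem_moore e n w h

/-- Any choice of elements is the restriction of an assignment. -/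
theorem exists_assignment (g : moore X 0) (h h' h'' h''' : moore X 1) (l l' l'' : moore X 2)
    (m m' : moore X 3) :
    ∃ e : Assignment X, e 0 0 = g ∧ (e 1 0 = h ∧ e 1 1 = h' ∧ e 1 2 = h'' ∧ e 1 3 = h''') ∧
      (e 2 0 = l ∧ e 2 1 = l' ∧ e 2 2 = l'') ∧ e 3 0 = m ∧ e 3 1 = m' :=
  ⟨fun k j ↦ match k with
    | 0 => g
    | 1 => [h, h', h'', h'''].getD j 1
    | 2 => [l, l', l''].getD j 1
    | 3 => [m, m'].getD j 1
    | _ + 4 => 1, by simp⟩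

/-! ### The boundary maps, the actions and the liftings -/

instance moore_normal (X : SimplicialGroup.{u}) (n : ℕ) : (moore X n).Normal := by
  obtain _ | n := n
  · exact inferInstanceAs (⊤ : Subgroup _).Normal
  · exact Subgroup.normal_iInf_normal fun _ ↦ inferInstance

instance (X : SimplicialGroup.{u}) : (boundaries X).Normal := boundaries_normal X

theorem face_mem_moore {n : ℕ} (hn : n < 3) (y : moore X (n + 1)) :
    face X n (Fin.last (n + 1)) y ∈ moore X n := by
  obtain ⟨e, rfl⟩ : ∃ e : Assignment X, e (n + 1) 0 = y :=
    ⟨Function.update (fun _ _ ↦ 1) (n + 1) fun _ ↦ y, by simp⟩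
  refine mem_moore_of_spells e n _ ?_
  interval_cases n <;> decide

/-- The boundary map of the Moore complex, given by the last face. -/
def mooreBoundary (X : SimplicialGroup.{u}) (n : ℕ) (hn : n < 3) : moore X (n + 1) →* moore X n :=
  ((face X n (Fin.last (n + 1))).comp (moore X (n + 1)).subtype).codRestrict _
    fun y ↦ face_mem_moore hn y

/-- The boundary map on the quotient of the third Moore group. -/
def topBoundary (X : SimplicialGroup.{u}) : TopQuotient X →* moore X 2 :=
  QuotientGroup.lift _ (mooreBoundary X 2 (by norm_num)) <| by
    rintro m ⟨y, hy, h⟩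
    obtain ⟨e, he⟩ : ∃ e : Assignment X, e 4 0 = ⟨y, hy⟩ :=
      ⟨Function.update (fun _ _ ↦ 1) 4 fun _ ↦ ⟨y, hy⟩, by simp⟩
    obtain rfl : (e 4 0 : X _⦋4⦌) = y := congrArg Subtype.val he
    apply Subtype.ext
    change face X 2 3 m = 1
    refine (congrArg (face X 2 3) h.symm).trans ?_
    exact eq_of_spells e 2 (by decide)

/-- Conjugation by elements of `X_3` on the quotient of the third Moore group. -/
def conjTopQuotient (X : SimplicialGroup.{u}) : X _⦋3⦌ →* MulAut (TopQuotient X) where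
  toFun x := QuotientGroup.congr _ _ (MulAut.conjNormal x) <| by
    ext m
    constructor
    · rintro ⟨y, hy, rfl⟩
      exact (boundaries_normal X).conj_mem _ hy x
    · intro hm
      refine ⟨(MulAut.conjNormal x).symm m, ?_, MulEquiv.apply_symm_apply _ _⟩
      exact (Subgroup.mem_subgroupOf.2 (by
        simpa using (boundaries_normal X).conj_mem _ (Subgroup.mem_subgroupOf.1 hm) x⁻¹))
  map_one' := by
    ext m
    induction m using QuotientGroup.induction_on
    simp
  map_mul' x y := by
    ext m
    induction m using QuotientGroup.induction_on
    simp

/-- The action of `G` on `H`. -/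
def actGH (X : SimplicialGroup.{u}) : moore X 0 →* MulAut (moore X 1) :=
  MulAut.conjNormal.comp ((degen X 0 0).comp (moore X 0).subtype)

/-- The action of `G` on `L`. -/
def actGL (X : SimplicialGroup.{u}) : moore X 0 →* MulAut (moore X 2) :=
  MulAut.conjNormal.comp ((s₁s₀' X).comp (moore X 0).subtype)

/-- The action of `H` on `L`. -/
def actHL (X : SimplicialGroup.{u}) : moore X 1 →* MulAut (moore X 2) :=
  MulAut.conjNormal.comp ((degen X 1 1).comp (moore X 1).subtype)

/-- The action of `G` on `M`. -/
def actGM (X : SimplicialGroup.{u}) : moore X 0 →* MulAut (TopQuotient X) :=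
  (conjTopQuotient X).comp ((s₂s₁s₀ X).comp (moore X 0).subtype)

/-- The action of `H` on `M`. -/
def actHM (X : SimplicialGroup.{u}) : moore X 1 →* MulAut (TopQuotient X) :=
  (conjTopQuotient X).comp ((s₂s₁ X).comp (moore X 1).subtype)

/-- The action of `L` on `M`. -/
def actLM (X : SimplicialGroup.{u}) : moore X 2 →* MulAut (TopQuotient X) :=
  (conjTopQuotient X).comp ((degen X 2 2).comp (moore X 2).subtype)

/-- The Peiffer lifting. -/
def peifferLift (h₁ h₂ : moore X 1) : moore X 2 :=
  ⟨peifferWord X h₁ h₂, by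
    obtain ⟨e, -, ⟨rfl, rfl, -⟩, -⟩ := exists_assignment 1 h₁ h₂ 1 1 1 1 1 1 1
    exact mem_moore_of_spells e 2 _ (by decide)⟩

/-- The LL-Peiffer lifting. -/
def llLift (l₁ l₂ : moore X 2) : TopQuotient X :=
  QuotientGroup.mk ⟨llWord X l₁ l₂, by
    obtain ⟨e, -, -, ⟨rfl, rfl, -⟩, -⟩ := exists_assignment 1 1 1 1 1 l₁ l₂ 1 1 1
    exact mem_moore_of_spells e 3 _ (by decide)⟩

/-- The HL-Peiffer lifting. -/
def hlLift (h : moore X 1) (l : moore X 2) : TopQuotient X :=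
  QuotientGroup.mk ⟨hlWord X h l, by
    obtain ⟨e, -, ⟨rfl, -⟩, ⟨rfl, -⟩, -⟩ := exists_assignment 1 h 1 1 1 l 1 1 1 1
    exact mem_moore_of_spells e 3 _ (by decide)⟩

/-- The HL'-Peiffer lifting. -/
def hl'Lift (h : moore X 1) (l : moore X 2) : TopQuotient X :=
  QuotientGroup.mk ⟨hl'Word X h l, by
    obtain ⟨e, -, ⟨rfl, -⟩, ⟨rfl, -⟩, -⟩ := exists_assignment 1 h 1 1 1 l 1 1 1 1
    exact mem_moore_of_spells e 3 _ (by decide)⟩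

/-- The left Homanian. -/
def leftHomanian (h₁ h₂ h₃ : moore X 1) : TopQuotient X :=
  QuotientGroup.mk ⟨lhWord X h₁ h₂ h₃, by
    obtain ⟨e, -, ⟨rfl, rfl, rfl, -⟩, -⟩ := exists_assignment 1 h₁ h₂ h₃ 1 1 1 1 1 1
    exact mem_moore_of_spells e 3 _ (by decide +kernel)⟩

/-- The right Homanian. -/
def rightHomanian (h₁ h₂ h₃ : moore X 1) : TopQuotient X :=
  QuotientGroup.mk ⟨rhWord X h₁ h₂ h₃, by
    obtain ⟨e, -, ⟨rfl, rfl, rfl, -⟩, -⟩ := exists_assignment 1 h₁ h₂ h₃ 1 1 1 1 1 1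
    exact mem_moore_of_spells e 3 _ (by decide +kernel)⟩

/-! ### Words of composite expressions -/

instance (n : ℕ) (y z : moore X n) (v w : Word) [Spells e n y v] [Spells e n z w] :
    Spells e n (y * z : moore X n) (v * w) :=
  inferInstanceAs (Spells e n (y * z : X _⦋n⦌) _)

instance (n : ℕ) (y : moore X n) (w : Word) [Spells e n y w] :
    Spells e n (y⁻¹ : moore X n) w⁻¹ :=
  inferInstanceAs (Spells e n (y : X _⦋n⦌)⁻¹ _)

instance (n : ℕ) : Spells e n (1 : moore X n) 1 := inferInstanceAs (Spells e n (1 : X _⦋n⦌) _)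

instance (hn : 0 < 3) (h : moore X 1) (w : Word) [Spells e 1 h w] :
    Spells e 0 (mooreBoundary X 0 hn h) (Word.face 1 w) :=
  inferInstanceAs (Spells e 0 (face X 0 (Fin.last 1) h) _)

instance (hn : 1 < 3) (l : moore X 2) (w : Word) [Spells e 2 l w] :
    Spells e 1 (mooreBoundary X 1 hn l) (Word.face 2 w) :=
  inferInstanceAs (Spells e 1 (face X 1 (Fin.last 2) l) _)

instance (g : moore X 0) (h : moore X 1) (v w : Word) [Spells e 0 g v] [Spells e 1 h w] :
    Spells e 1 (actGH X g h) (Word.degen 0 v * w * (Word.degen 0 v)⁻¹) :=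
  inferInstanceAs (Spells e 1 (degen X 0 0 g * h * (degen X 0 0 g)⁻¹) _)

instance (g : moore X 0) (l : moore X 2) (v w : Word) [Spells e 0 g v] [Spells e 2 l w] :
    Spells e 2 (actGL X g l)
      (Word.degen 1 (Word.degen 0 v) * w * (Word.degen 1 (Word.degen 0 v))⁻¹) :=
  inferInstanceAs (Spells e 2 (s₁s₀' X g * l * (s₁s₀' X g)⁻¹) _)

instance (h : moore X 1) (l : moore X 2) (v w : Word) [Spells e 1 h v] [Spells e 2 l w] :
    Spells e 2 (actHL X h l) (Word.degen 1 v * w * (Word.degen 1 v)⁻¹) :=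
  inferInstanceAs (Spells e 2 (degen X 1 1 h * l * (degen X 1 1 h)⁻¹) _)

instance (y z : moore X 1) (v w : Word) [Spells e 1 y v] [Spells e 1 z w] :
    Spells e 2 (peifferLift y z) (Word.peiffer v w) :=
  inferInstanceAs (Spells e 2 (peifferWord X y z) _)

/-- The element `m` of the quotient of the third Moore group is the class of the value of the word
`w`. As for `Spells`, the word is computed by instances. -/
class SpellsClass (m : TopQuotient X) (w : outParam Word) : Prop where
  isClassOf : IsClassOf X m (eval e 3 w)

theorem spellsClass_mk (y : X _⦋3⦌) (hy : y ∈ moore X 3) (w : Word) [h : Spells e 3 y w] :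
    SpellsClass e (QuotientGroup.mk (⟨y, hy⟩ : moore X 3) : TopQuotient X) w := by
  obtain rfl := h.eq
  exact ⟨⟨hy, rfl⟩⟩

instance (y : moore X 3) (w : Word) [Spells e 3 y w] :
    SpellsClass e (QuotientGroup.mk y : TopQuotient X) w := spellsClass_mk e y y.2 w

instance (y z : TopQuotient X) (v w : Word) [hy : SpellsClass e y v] [hz : SpellsClass e z w] :
    SpellsClass e (y * z) (v * w) := by
  obtain ⟨⟨h, rfl⟩⟩ := hy
  obtain ⟨⟨h', rfl⟩⟩ := hz
  refine ⟨?_⟩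
  rw [map_mul]
  exact ⟨mul_mem h h', rfl⟩

instance (y : TopQuotient X) (w : Word) [hy : SpellsClass e y w] : SpellsClass e y⁻¹ w⁻¹ := by
  obtain ⟨⟨h, rfl⟩⟩ := hy
  refine ⟨?_⟩
  rw [map_inv]
  exact ⟨inv_mem h, rfl⟩

instance (m : TopQuotient X) (w : Word) [hm : SpellsClass e m w] :
    Spells e 2 (topBoundary X m) (Word.face 3 w) := by
  obtain ⟨⟨h, rfl⟩⟩ := hm
  exact ⟨(eval_face e 2 3 w).symm⟩

theorem spellsClass_conj (y : X _⦋3⦌) (m : TopQuotient X) (v w : Word) [hy : Spells e 3 y v]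
    [hm : SpellsClass e m w] : SpellsClass e (conjTopQuotient X y m) (v * w * v⁻¹) := by
  obtain ⟨⟨h, rfl⟩⟩ := hm
  refine ⟨?_⟩
  rw [map_mul, map_mul, map_inv, ← hy.eq]
  exact ⟨(moore_normal X 3).conj_mem _ h y, rfl⟩

instance (g : moore X 0) (m : TopQuotient X) (v w : Word) [Spells e 0 g v] [SpellsClass e m w] :
    SpellsClass e (actGM X g m)
      (Word.degen 2 (Word.degen 1 (Word.degen 0 v)) * w *
        (Word.degen 2 (Word.degen 1 (Word.degen 0 v)))⁻¹) :=
  spellsClass_conj e (s₂s₁s₀ X g) m _ w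

instance (h : moore X 1) (m : TopQuotient X) (v w : Word) [Spells e 1 h v] [SpellsClass e m w] :
    SpellsClass e (actHM X h m) (Word.s₂s₁ v * w * (Word.s₂s₁ v)⁻¹) :=
  spellsClass_conj e (s₂s₁ X h) m _ w

instance (l : moore X 2) (m : TopQuotient X) (v w : Word) [Spells e 2 l v] [SpellsClass e m w] :
    SpellsClass e (actLM X l m) (Word.degen 2 v * w * (Word.degen 2 v)⁻¹) :=
  spellsClass_conj e (degen X 2 2 l) m _ w

instance (y z : moore X 2) (v w : Word) [Spells e 2 y v] [Spells e 2 z w] :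
    SpellsClass e (llLift y z) (Word.ll v w) := spellsClass_mk e (llWord X y z) _ _

instance (y : moore X 1) (z : moore X 2) (v w : Word) [Spells e 1 y v] [Spells e 2 z w] :
    SpellsClass e (hlLift y z) (Word.hl v w) := spellsClass_mk e (hlWord X y z) _ _

instance (y : moore X 1) (z : moore X 2) (v w : Word) [Spells e 1 y v] [Spells e 2 z w] :
    SpellsClass e (hl'Lift y z) (Word.hl' v w) := spellsClass_mk e (hl'Word X y z) _ _

instance (x y z : moore X 1) (u v w : Word) [Spells e 1 x u] [Spells e 1 y v] [Spells e 1 z w] :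
    SpellsClass e (leftHomanian x y z) (Word.lh u v w) := spellsClass_mk e (lhWord X x y z) _ _

instance (x y z : moore X 1) (u v w : Word) [Spells e 1 x u] [Spells e 1 y v] [Spells e 1 z w] :
    SpellsClass e (rightHomanian x y z) (Word.rh u v w) := spellsClass_mk e (rhWord X x y z) _ _

theorem moore_ext_of_spells {n : ℕ} {y z : moore X n} {v w : Word} [Spells e n y v]
    [Spells e n z w] (h : Word.prune v = Word.prune w := by decide +kernel) : y = z :=
  Subtype.ext (eq_of_spells e n h)

/-- An equation in the quotient of the third Moore group holds as soon as the faces of its two sides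
agree as words. -/
theorem eq_of_spellsClass {y z : TopQuotient X} {v w : Word} [hy : SpellsClass e y v]
    [hz : SpellsClass e z w]
    (h : ∀ a < 4, Word.prune (Word.face a v) = Word.prune (Word.face a w) := by
      decide +kernel)
    (h₄ : Word.face 4 v = v ∧ Word.face 4 w = w := by decide +kernel) : y = z := by
  obtain ⟨⟨_, rfl⟩⟩ := hy
  obtain ⟨⟨_, rfl⟩⟩ := hz
  exact QuotientGroup.eq.2
    (Subgroup.mem_subgroupOf.2 (inv_mul_eval_mem_boundaries e h h₄))

/-! ### The axioms -/

/-- The 3-crossed module of a simplicial group. In each axiom the elements are written as values of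
an assignment, after which the axiom is an equality of words; the check is done by the default
arguments of `moore_ext_of_spells` and `eq_of_spellsClass`. -/
def threeCrossedModule (X : SimplicialGroup.{u}) :
    ThreeCrossedModule (moore X 0) (moore X 1) (moore X 2) (TopQuotient X) where
  dM := topBoundary X
  dL := mooreBoundary X 1 (by norm_num)
  dH := mooreBoundary X 0 (by norm_num)
  actGH := actGH X
  actGL := actGL X
  actGM := actGM X
  actHL := actHL X
  actHM := actHM X
  actLM := actLM X
  pf := peifferLift
  lh := leftHomanian
  rh := rightHomanian
  hl := hlLift
  hl' := hl'Lift
  ll := llLift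
  dL_dM m := by
    obtain ⟨m, rfl⟩ := QuotientGroup.mk_surjective m
    obtain ⟨e, -, -, -, rfl, -⟩ := exists_assignment 1 1 1 1 1 1 1 1 m 1
    exact moore_ext_of_spells e
  dH_dL l := by
    obtain ⟨e, -, -, ⟨rfl, -⟩, -⟩ := exists_assignment 1 1 1 1 1 l 1 1 1 1
    exact moore_ext_of_spells e
  dH_actGH g h := by
    obtain ⟨e, rfl, ⟨rfl, -⟩, -⟩ := exists_assignment g h 1 1 1 1 1 1 1 1
    exact moore_ext_of_spells e
  dL_actGL g l := by
    obtain ⟨e, rfl, -, ⟨rfl, -⟩, -⟩ := exists_assignment g 1 1 1 1 l 1 1 1 1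
    exact moore_ext_of_spells e
  dM_actGM g m := by
    obtain ⟨m, rfl⟩ := QuotientGroup.mk_surjective m
    obtain ⟨e, rfl, -, -, rfl, -⟩ := exists_assignment g 1 1 1 1 1 1 1 m 1
    exact moore_ext_of_spells e
  dL_actHL h l := by
    obtain ⟨e, -, ⟨rfl, -⟩, ⟨rfl, -⟩, -⟩ := exists_assignment 1 h 1 1 1 l 1 1 1 1
    exact moore_ext_of_spells e
  dM_actHM h m := by
    obtain ⟨m, rfl⟩ := QuotientGroup.mk_surjective m
    obtain ⟨e, -, ⟨rfl, -⟩, -, rfl, -⟩ := exists_assignment 1 h 1 1 1 1 1 1 m 1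
    exact moore_ext_of_spells e
  dM_actLM l m := by
    obtain ⟨m, rfl⟩ := QuotientGroup.mk_surjective m
    obtain ⟨e, -, -, ⟨rfl, -⟩, rfl, -⟩ := exists_assignment 1 1 1 1 1 l 1 1 m 1
    exact moore_ext_of_spells e
  actG_pf g h₂ h₁ := by
    obtain ⟨e, rfl, ⟨rfl, rfl, -⟩, -⟩ := exists_assignment g h₂ h₁ 1 1 1 1 1 1 1
    exact moore_ext_of_spells e
  actG_lh g h₃ h₂ h₁ := by
    obtain ⟨e, rfl, ⟨rfl, rfl, rfl, -⟩, -⟩ := exists_assignment g h₃ h₂ h₁ 1 1 1 1 1 1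
    exact eq_of_spellsClass e
  actG_rh g h₃ h₂ h₁ := by
    obtain ⟨e, rfl, ⟨rfl, rfl, rfl, -⟩, -⟩ := exists_assignment g h₃ h₂ h₁ 1 1 1 1 1 1
    exact eq_of_spellsClass e
  actG_ll g l₂ l₁ := by
    obtain ⟨e, rfl, -, ⟨rfl, rfl, -⟩, -⟩ := exists_assignment g 1 1 1 1 l₂ l₁ 1 1 1
    exact eq_of_spellsClass e
  actH_ll h l₂ l₁ := by
    obtain ⟨e, -, ⟨rfl, -⟩, ⟨rfl, rfl, -⟩, -⟩ := exists_assignment 1 h 1 1 1 l₂ l₁ 1 1 1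
    exact eq_of_spellsClass e
  actLM_dM m m' := by
    obtain ⟨m, rfl⟩ := QuotientGroup.mk_surjective m
    obtain ⟨m', rfl⟩ := QuotientGroup.mk_surjective m'
    obtain ⟨e, -, -, -, rfl, rfl⟩ := exists_assignment 1 1 1 1 1 1 1 1 m m'
    exact eq_of_spellsClass e
  dM_hl h l := by
    obtain ⟨e, -, ⟨rfl, -⟩, ⟨rfl, -⟩, -⟩ := exists_assignment 1 h 1 1 1 l 1 1 1 1
    exact moore_ext_of_spells e
  dM_hl' h l := by
    obtain ⟨e, -, ⟨rfl, -⟩, ⟨rfl, -⟩, -⟩ := exists_assignment 1 h 1 1 1 l 1 1 1 1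
    exact moore_ext_of_spells e
  actG_hl g h l := by
    obtain ⟨e, rfl, ⟨rfl, -⟩, ⟨rfl, -⟩, -⟩ := exists_assignment g h 1 1 1 l 1 1 1 1
    exact eq_of_spellsClass e
  actG_hl' g h l := by
    obtain ⟨e, rfl, ⟨rfl, -⟩, ⟨rfl, -⟩, -⟩ := exists_assignment g h 1 1 1 l 1 1 1 1
    exact eq_of_spellsClass e
  actHM_eq h m := by
    obtain ⟨m, rfl⟩ := QuotientGroup.mk_surjective m
    obtain ⟨e, -, ⟨rfl, -⟩, -, rfl, -⟩ := exists_assignment 1 h 1 1 1 1 1 1 m 1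
    exact eq_of_spellsClass e
  dM_ll l l' := by
    obtain ⟨e, -, -, ⟨rfl, rfl, -⟩, -⟩ := exists_assignment 1 1 1 1 1 l l' 1 1 1
    exact moore_ext_of_spells e
  ll_mul_left l₃ l₂ l₁ := by
    obtain ⟨e, -, -, ⟨rfl, rfl, rfl⟩, -⟩ := exists_assignment 1 1 1 1 1 l₃ l₂ l₁ 1 1
    exact eq_of_spellsClass e
  ll_mul_right l₃ l₂ l₁ := by
    obtain ⟨e, -, -, ⟨rfl, rfl, rfl⟩, -⟩ := exists_assignment 1 1 1 1 1 l₃ l₂ l₁ 1 1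
    exact eq_of_spellsClass e
  actGM_dH h m := by
    obtain ⟨m, rfl⟩ := QuotientGroup.mk_surjective m
    obtain ⟨e, -, ⟨rfl, -⟩, -, rfl, -⟩ := exists_assignment 1 h 1 1 1 1 1 1 m 1
    exact eq_of_spellsClass e
  pf_mul_left h₃ h₂ h₁ := by
    obtain ⟨e, -, ⟨rfl, rfl, rfl, -⟩, -⟩ := exists_assignment 1 h₃ h₂ h₁ 1 1 1 1 1 1
    exact moore_ext_of_spells e
  pf_mul_right h₃ h₂ h₁ := by
    obtain ⟨e, -, ⟨rfl, rfl, rfl, -⟩, -⟩ := exists_assignment 1 h₃ h₂ h₁ 1 1 1 1 1 1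
    exact moore_ext_of_spells e
  hl_mul_left h₂ h₁ l := by
    obtain ⟨e, -, ⟨rfl, rfl, -⟩, ⟨rfl, -⟩, -⟩ := exists_assignment 1 h₂ h₁ 1 1 l 1 1 1 1
    exact eq_of_spellsClass e
  hl_mul_right h l₂ l₁ := by
    obtain ⟨e, -, ⟨rfl, -⟩, ⟨rfl, rfl, -⟩, -⟩ := exists_assignment 1 h 1 1 1 l₂ l₁ 1 1 1
    exact eq_of_spellsClass e
  hl'_mul_left h₂ h₁ l := by
    obtain ⟨e, -, ⟨rfl, rfl, -⟩, ⟨rfl, -⟩, -⟩ := exists_assignment 1 h₂ h₁ 1 1 l 1 1 1 1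
    exact eq_of_spellsClass e
  hl'_mul_right h l₂ l₁ := by
    obtain ⟨e, -, ⟨rfl, -⟩, ⟨rfl, rfl, -⟩, -⟩ := exists_assignment 1 h 1 1 1 l₂ l₁ 1 1 1
    exact eq_of_spellsClass e
  lh_cocycle h₄ h₃ h₂ h₁ := by
    obtain ⟨e, -, ⟨rfl, rfl, rfl, rfl⟩, -⟩ := exists_assignment 1 h₄ h₃ h₂ h₁ 1 1 1 1 1
    exact eq_of_spellsClass e
  rh_cocycle h₄ h₃ h₂ h₁ := by
    obtain ⟨e, -, ⟨rfl, rfl, rfl, rfl⟩, -⟩ := exists_assignment 1 h₄ h₃ h₂ h₁ 1 1 1 1 1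
    exact eq_of_spellsClass e
  lh_rh h₄ h₃ h₂ h₁ := by
    obtain ⟨e, -, ⟨rfl, rfl, rfl, rfl⟩, -⟩ := exists_assignment 1 h₄ h₃ h₂ h₁ 1 1 1 1 1
    exact eq_of_spellsClass e
  yang_baxter h₃ h₂ h₁ := by
    obtain ⟨e, -, ⟨rfl, rfl, rfl, -⟩, -⟩ := exists_assignment 1 h₃ h₂ h₁ 1 1 1 1 1 1
    exact eq_of_spellsClass e
  hl_ll_hl' l l' := by
    obtain ⟨e, -, -, ⟨rfl, rfl, -⟩, -⟩ := exists_assignment 1 1 1 1 1 l l' 1 1 1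
    exact eq_of_spellsClass e
  ll_mul_ll_eq_hl l m := by
    obtain ⟨m, rfl⟩ := QuotientGroup.mk_surjective m
    obtain ⟨e, -, -, ⟨rfl, -⟩, rfl, -⟩ := exists_assignment 1 1 1 1 1 l 1 1 m 1
    exact eq_of_spellsClass e
  hl_eq_hl'_inv l m := by
    obtain ⟨m, rfl⟩ := QuotientGroup.mk_surjective m
    obtain ⟨e, -, -, ⟨rfl, -⟩, rfl, -⟩ := exists_assignment 1 1 1 1 1 l 1 1 m 1
    exact eq_of_spellsClass e
  ll_dM_dM m m' := by
    obtain ⟨m, rfl⟩ := QuotientGroup.mk_surjective m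
    obtain ⟨m', rfl⟩ := QuotientGroup.mk_surjective m'
    obtain ⟨e, -, -, -, rfl, rfl⟩ := exists_assignment 1 1 1 1 1 1 1 1 m m'
    exact eq_of_spellsClass e

end SimplicialGroup

open SimplicialGroup in
theorem mainTheorem3 (X : SimplicialGroup.{u}) :
    ∃ T : ThreeCrossedModule (moore X 0) (moore X 1) (moore X 2) (TopQuotient X),
      -- the boundary maps are induced by the last faces
      (∀ h : moore X 1, (T.dH h : X _⦋0⦌) = face X 0 1 h) ∧
      (∀ l : moore X 2, (T.dL l : X _⦋1⦌) = face X 1 2 l) ∧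
      (∀ m : moore X 3, (T.dM (QuotientGroup.mk m) : X _⦋2⦌) = face X 2 3 m) ∧
      -- the actions
      (∀ (g : moore X 0) (h : moore X 1),
        (T.actGH g h : X _⦋1⦌) = degen X 0 0 g * h * degen X 0 0 (g : X _⦋0⦌)⁻¹) ∧
      (∀ (g : moore X 0) (l : moore X 2),
        (T.actGL g l : X _⦋2⦌) = s₁s₀' X g * l * s₁s₀' X (g : X _⦋0⦌)⁻¹) ∧
      (∀ (g : moore X 0) (m : moore X 3),
        IsClassOf X (T.actGM g (QuotientGroup.mk m))
          (s₂s₁s₀ X g * m * s₂s₁s₀ X (g : X _⦋0⦌)⁻¹)) ∧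
      (∀ (h : moore X 1) (l : moore X 2),
        (T.actHL h l : X _⦋2⦌) = degen X 1 1 h * l * degen X 1 1 (h : X _⦋1⦌)⁻¹) ∧
      (∀ (h : moore X 1) (m : moore X 3),
        IsClassOf X (T.actHM h (QuotientGroup.mk m))
          (s₂s₁ X h * m * s₂s₁ X (h : X _⦋1⦌)⁻¹)) ∧
      (∀ (l : moore X 2) (m : moore X 3),
        IsClassOf X (T.actLM l (QuotientGroup.mk m))
          (degen X 2 2 l * m * degen X 2 2 (l : X _⦋2⦌)⁻¹)) ∧
      -- the liftings
      (∀ h₁ h₂ : moore X 1, (T.pf h₁ h₂ : X _⦋2⦌) = peifferWord X h₁ h₂) ∧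
      (∀ l₁ l₂ : moore X 2, IsClassOf X (T.ll l₁ l₂) (llWord X l₁ l₂)) ∧
      (∀ (h : moore X 1) (l : moore X 2), IsClassOf X (T.hl h l) (hlWord X h l)) ∧
      (∀ (h : moore X 1) (l : moore X 2), IsClassOf X (T.hl' h l) (hl'Word X h l)) ∧
      (∀ h₁ h₂ h₃ : moore X 1, IsClassOf X (T.lh h₁ h₂ h₃) (lhWord X h₁ h₂ h₃)) ∧
      (∀ h₁ h₂ h₃ : moore X 1, IsClassOf X (T.rh h₁ h₂ h₃) (rhWord X h₁ h₂ h₃)) ∧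
      -- the boundary of the Peiffer lifting
      (∀ h₂ h₁ : moore X 1,
        T.dL (T.pf h₂ h₁) = h₂ * h₁ * h₂⁻¹ * T.actGH (T.dH h₂) h₁⁻¹) := by
  have conj_class (x : X _⦋3⦌) (m : moore X 3) :
      IsClassOf X (conjTopQuotient X x (QuotientGroup.mk m)) (x * m * x⁻¹) :=
    ⟨(moore_normal X 3).conj_mem _ m.2 x, rfl⟩
  refine ⟨threeCrossedModule X, fun _ ↦ rfl, fun _ ↦ rfl, fun _ ↦ rfl, ?_, ?_, ?_, ?_, ?_, ?_,
    fun _ _ ↦ rfl, fun _ _ ↦ ⟨_, rfl⟩, fun _ _ ↦ ⟨_, rfl⟩, fun _ _ ↦ ⟨_, rfl⟩,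
    fun _ _ _ ↦ ⟨_, rfl⟩, fun _ _ _ ↦ ⟨_, rfl⟩, fun h₂ h₁ ↦ ?_⟩
  · intro g h
    rw [map_inv]
    rfl
  · intro g l
    rw [map_inv]
    rfl
  · intro g m
    rw [map_inv]
    exact conj_class _ m
  · intro h l
    rw [map_inv]
    rfl
  · intro h m
    rw [map_inv]
    exact conj_class _ m
  · intro l m
    rw [map_inv]
    exact conj_class _ m
  · obtain ⟨e, -, ⟨rfl, rfl, -⟩, -⟩ := exists_assignment 1 h₂ h₁ 1 1 1 1 1 1 1
    change mooreBoundary X 1 (by norm_num) (peifferLift (e 1 0) (e 1 1)) =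
      e 1 0 * e 1 1 * (e 1 0)⁻¹ * actGH X (mooreBoundary X 0 (by norm_num) (e 1 0)) (e 1 1)⁻¹
    exact moore_ext_of_spells e
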